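/- Consider finite simple undirected graphs $G$ (not necessarily connected) with $n$ vertices, whose vertices carry distinct identifiers in $\{1,\dots,n^c\}$, where $c\ge 1$ is a fixed integer. A local certification with verification radius $1$ and size $s(n)$ of a graph property $P$ is a verification algorithm, that is, an accept/reject function of the radius-$1$ view of a vertex $v$ (the identifier of $v$, the identifiers and certificates of $v$ and of its neighbours, and the edges at $v$; certificates are finite bit strings), such that, for every $n$, every $n$-vertex graph $G$ and every assignment of identifiers: if $G$ satisfies $P$, then some assignment of certificates of at most $s(n)$ bits makes all vertices accept; if $G$ does not satisfy $P$, then for every assignment of certificates at least one vertex rejects. Let $T$ be a finite tree, and let $P_T$ be the property that $G$ does not contain $T$ as a (not necessarily induced) subgraph. (i) For every $c\ge 1$, the property $P_T$ has a local certification with verification radius $1$ and size $O(\log n)$, where the implied constant depends only on $T$ and $c$. (ii) This is tight for every tree with large enough diameter, namely at least $4$: if $T$ has diameter at least $4$, then there are $\varepsilon>0$ and $N$, depending only on $T$, such that for every $c\ge 1$, every local certification of $P_T$ with verification radius $1$ has size $s(n)\ge \varepsilon\log n$ for all $n\ge N$. -/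

import Mathlib

namespace LocalCert

/-- What a vertex sees. Vertices are named by their (unique) identifiers:
`center` is the identifier of the observing vertex, `nodes` the set of pairs
(identifier, certificate) in sight, `edges` the set of visible edges, each one as both
ordered pairs of the identifiers of its ends. -/
structure View where
  center : ℕ
  nodes : Set (ℕ × List Bool)
  edges : Set (ℕ × ℕ)

/-- The view at distance `d` of the vertex `v`: the vertices at distance at most `d` from `v`, with
their identifiers and certificates, and the edges between them, except the edges between two
vertices at distance exactly `d`. (`edist` is the distance with value `⊤` across components.) -/
def view {V : Type} (G : SimpleGraph V) (ident : V → ℕ) (cert : V → List Bool) (d : ℕ) (v : V) :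
    View where
  center := ident v
  nodes := {p | ∃ u, G.edist v u ≤ d ∧ p = (ident u, cert u)}
  edges := {p | ∃ a b, G.Adj a b ∧ G.edist v a ≤ d ∧ G.edist v b ≤ d ∧
    ¬ (G.edist v a = d ∧ G.edist v b = d) ∧ p = (ident a, ident b)}

/-- Identifiers on `O(log n)` bits: distinct numbers in `{1, …, n ^ c}`, where `n` is the number of
vertices. -/
def IsIdentifier {V : Type} [Fintype V] (c : ℕ) (ident : V → ℕ) : Prop :=
  Function.Injective ident ∧ ∀ v, 1 ≤ ident v ∧ ident v ≤ Fintype.card V ^ c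

/-- `HasLocalCertification c d P s`: for networks with identifiers in `{1, …, n ^ c}`, there is a
local certification of the graph property `P` with verification radius `d` and with certificates of
at most `s n` bits on `n`-vertex graphs. The verification algorithm `accept` is a function of the
view only; in particular it is not told `n`. -/
def HasLocalCertification (c d : ℕ) (P : ∀ V : Type, SimpleGraph V → Prop) (s : ℕ → ℕ) : Prop :=
  ∃ accept : View → Prop,
    ∀ (V : Type) [Fintype V] (G : SimpleGraph V) (ident : V → ℕ), IsIdentifier c ident →
      (P V G → ∃ cert : V → List Bool, (∀ v, (cert v).length ≤ s (Fintype.card V)) ∧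
        ∀ v, accept (view G ident cert d v)) ∧
      (¬ P V G → ∀ cert : V → List Bool, ∃ v, ¬ accept (view G ident cert d v))

end LocalCert

/-! Upper bound: colour coding. Root `T` at `r` and colour identifiers by vertices of `T`. For a
fixed colouring, one bit per vertex marks the roots of correctly coloured branches, and each vertex
checks the closure rule locally; a marked vertex of colour `r` exposes a copy of `T`
(`IsBranchRoot.isContained`), and on a correctly coloured copy the rule forces a mark at the root
(`Copy.mem_of_closed`). By `exists_perfect_hash_family`, `O(log n)` colourings suffice to colour
every possible copy correctly.

Lower bound: cut and paste. Moving a leaf edge `pw` to `pu`, with `u` far from `p`, leaves too few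
vertices for `T`; crossing the moved edges of two such graphs creates `T`. Place the part near `u`
in one of many blocks and the rest in another. With short certificates,
`exists_monochromatic_rectangle` gives two blocks of each kind whose four combinations have equal
certificates, and every view in the crossed graph already occurs in an accepted one
(`IsFarLeaf.exists_place`). -/

namespace SimpleGraph

/-! ### Rooted trees and coloured branches -/

variable {W : Type*} {T : SimpleGraph W}

/-- In a tree, every vertex has at most one neighbour that is closer to the root `r`. -/
lemma IsTree.eq_of_adj_of_dist_add_one (hT : T.IsTree) {r v y z : W} (hy : T.Adj y v)
    (hz : T.Adj z v) (hdy : T.dist r v = T.dist r y + 1) (hdz : T.dist r v = T.dist r z + 1) :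
    y = z := by
  have key : ∀ x, T.Adj x v → T.dist r v = T.dist r x + 1 →
      ∃ p : T.Walk r v, p.IsPath ∧ p.penultimate = x := by
    intro x hx hd
    obtain ⟨q, hq⟩ := (hT.1 r x).exists_walk_length_eq_dist
    refine ⟨q.concat hx, Walk.isPath_of_length_eq_dist _ ?_, by simp⟩
    rw [Walk.length_concat, hq, hd]
  obtain ⟨p, hp, rfl⟩ := key y hy hdy
  obtain ⟨q, hq, rfl⟩ := key z hz hdz
  rw [(hT.existsUnique_path r v).unique hp hq]

lemma IsTree.dist_eq_add_one_or (hT : T.IsTree) (r : W) {a b : W} (h : T.Adj a b) :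
    T.dist r b = T.dist r a + 1 ∨ T.dist r a = T.dist r b + 1 := by
  have h1 := hT.dist_ne_of_adj r h
  have h2 := h.diff_dist_adj (u := r)
  omega

lemma Connected.exists_adj_dist_add_one (hT : T.Connected) {r v : W} (h : v ≠ r) :
    ∃ y, T.Adj y v ∧ T.dist r v = T.dist r y + 1 := by
  obtain ⟨q, hq⟩ := (hT v r).exists_walk_length_eq_dist
  cases q with
  | nil => exact absurd rfl h
  | @cons _ y _ hy q =>
    refine ⟨y, hy.symm, ?_⟩
    have h1 := dist_le q
    have h2 := hT.dist_triangle (u := v) (v := y) (w := r)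
    rw [dist_eq_one_iff_adj.2 hy] at h2
    rw [Walk.length_cons] at hq
    rw [dist_comm (u := r), dist_comm (u := r)]
    omega

/-- `w` is a child of `a` in the tree `T` rooted at `r`. -/
def IsChild (T : SimpleGraph W) (r a w : W) : Prop :=
  T.Adj a w ∧ T.dist r w = T.dist r a + 1

variable {V : Type*} {G : SimpleGraph V}

/-- `v` is the root of a colour-preserving copy of the subtree of `T` that hangs below the
colour of `v`, where `T` is rooted at `r`. -/
inductive IsBranchRoot (T : SimpleGraph W) (r : W) (G : SimpleGraph V) (col : V → W) : V → Prop
  | intro (v : V) (f : W → V) (adj : ∀ w, T.IsChild r (col v) w → G.Adj v (f w))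
      (color : ∀ w, T.IsChild r (col v) w → col (f w) = w)
      (branch : ∀ w, T.IsChild r (col v) w → IsBranchRoot T r G col (f w)) :
      IsBranchRoot T r G col v

/-- The branches are glued from the root downwards. Injectivity is automatic, since the colour of
each image recovers its preimage. -/
lemma IsBranchRoot.isContained (hT : T.IsTree) {r : W} {col : V → W} {v : V}
    (h : IsBranchRoot T r G col v) (hv : col v = r) : T.IsContained G := by
  classical
  let S := {v // IsBranchRoot T r G col v}
  have hnext : ∀ s : S, ∃ f : W → S, ∀ w, T.IsChild r (col s) w →
      G.Adj s (f w) ∧ col (f w) = w := by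
    rintro ⟨s, hs⟩
    obtain ⟨_, f, h1, h2, h3⟩ := id hs
    refine ⟨fun w ↦ if hw : T.IsChild r (col s) w then ⟨f w, h3 w hw⟩ else ⟨s, hs⟩, ?_⟩
    intro w hw
    change T.IsChild r (col s) w at hw
    simp only [dif_pos hw]
    exact ⟨h1 w hw, h2 w hw⟩
  choose next hnext using hnext
  have hpar : ∀ w, ∃ y, w ≠ r → T.Adj y w ∧ T.dist r w = T.dist r y + 1 := by
    intro w
    by_cases hw : w = r
    · exact ⟨w, fun h ↦ absurd hw h⟩
    · obtain ⟨y, hy⟩ := hT.1.exists_adj_dist_add_one hw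
      exact ⟨y, fun _ ↦ hy⟩
  choose par hpar using hpar
  -- Recursion on depth: `F n w` is meaningful only for `n = T.dist r w`.
  let F : ℕ → W → S := fun n ↦ Nat.rec (fun _ ↦ ⟨v, h⟩) (fun _ f w ↦ next (f (par w)) w) n
  have hF0 : ∀ w, F 0 w = ⟨v, h⟩ := fun _ ↦ rfl
  have hFs : ∀ n w, F (n + 1) w = next (F n (par w)) w := fun _ _ ↦ rfl
  have hcol : ∀ n w, T.dist r w = n → col (F n w).1 = w := by
    intro n
    induction n with
    | zero =>
      intro w hw
      rw [hF0, hv]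
      exact (hT.1.dist_eq_zero_iff).1 hw
    | succ n ih =>
      intro w hw
      have hwr : w ≠ r := by
        rintro rfl
        simp at hw
      obtain ⟨h1, h2⟩ := hpar w hwr
      rw [hFs]
      refine (hnext _ w ?_).2
      rw [ih _ (by omega)]
      exact ⟨h1, h2⟩
  let f : W → V := fun w ↦ (F (T.dist r w) w).1
  have hfcol : ∀ w, col (f w) = w := fun w ↦ hcol _ w rfl
  have hadj : ∀ a b, T.Adj a b → T.dist r b = T.dist r a + 1 → G.Adj (f a) (f b) := by
    intro a b hab hd
    have hbr : b ≠ r := by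
      rintro rfl
      simp at hd
    obtain ⟨h1, h2⟩ := hpar b hbr
    have hpa : par b = a := hT.eq_of_adj_of_dist_add_one h1 hab h2 hd
    have : f b = (next (F (T.dist r a) a) b).1 := by
      change (F (T.dist r b) b).1 = _
      rw [hd, hFs, hpa]
    rw [this]
    refine (hnext _ b ?_).1
    rw [hcol _ a rfl]
    exact ⟨hab, hd⟩
  refine ⟨⟨⟨f, ?_⟩, fun a b hab ↦ ?_⟩⟩
  · intro a b hab
    rcases hT.dist_eq_add_one_or r hab with hd | hd
    · exact hadj a b hab hd
    · exact (hadj b a hab.symm hd).symm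
  · rw [← hfcol a, ← hfcol b]
    exact congrArg col hab

/-- A set of vertices that is closed under the rule generating `IsBranchRoot` contains every
properly coloured copy of `T`. -/
lemma Copy.mem_of_closed [Finite W] (r : W) {col : V → W} {b : V → Prop} (φ : Copy T G)
    (hφ : ∀ w, col (φ w) = w)
    (hb : ∀ v ∈ Set.range φ,
      (∀ w, T.IsChild r (col v) w → ∃ x, G.Adj v x ∧ col x = w ∧ b x) → b v) (w : W) :
    b (φ w) := by
  obtain ⟨D, hD⟩ := (Set.finite_range (T.dist r)).bddAbove
  have hD : ∀ w, T.dist r w ≤ D := fun w ↦ hD ⟨w, rfl⟩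
  induction hn : D - T.dist r w using Nat.strong_induction_on generalizing w with
  | _ n ih =>
    refine hb _ ⟨w, rfl⟩ fun y hy ↦ ?_
    rw [hφ] at hy
    have := hD y
    have := hy.2
    exact ⟨φ y, φ.toHom.map_adj hy.1, hφ y, ih (D - T.dist r y) (by omega) y rfl⟩

end SimpleGraph

/-! ### Colour coding and perfect hash families -/

namespace LocalCert

open Finset

/-- A colouring is recovered from its restriction along `φ` and its correction to a left inverse of
`φ`; with `k = Fintype.card W`, a fraction at least `1 / k ^ k` of all colourings are thus left
inverses. -/
lemma card_pow_le_mul_card_leftInverse {α W : Type*} [Fintype α] [Fintype W] [DecidableEq α]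
    [DecidableEq W] {φ : W → α} (hφ : Function.Injective φ) :
    Fintype.card W ^ Fintype.card α ≤ Fintype.card W ^ Fintype.card W *
      #{g : α → W | ∀ w, g (φ w) = w} := by
  classical
  have : Fintype.card (α → W) ≤
      Fintype.card ((W → W) × {g : α → W // ∀ w, g (φ w) = w}) := by
    let ext : (α → W) → (α → W) := fun g ↦ Function.extend φ id g
    refine Fintype.card_le_of_injective
      (fun g ↦ (g ∘ φ, ⟨ext g, fun w ↦ hφ.extend_apply id g w⟩)) ?_
    intro g g' h
    simp only [Prod.mk.injEq, Subtype.mk.injEq] at h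
    funext a
    by_cases ha : ∃ w, φ w = a
    · obtain ⟨w, rfl⟩ := ha
      exact congrFun h.1 w
    · have := congrFun h.2 a
      simpa only [ext, Function.extend_apply' _ _ _ ha] using this
  rwa [Fintype.card_prod, Fintype.card_fun, Fintype.card_fun, Fintype.card_subtype] at this

/-- Averaging over all colourings, by double counting. -/
lemma exists_leftInverse_of_many {α W : Type*} [Fintype α] [Fintype W] [Nonempty W]
    [DecidableEq α] [DecidableEq W] (S : Finset (W → α)) (hS : ∀ φ ∈ S, Function.Injective φ) :
    ∃ g : α → W, #S ≤ Fintype.card W ^ Fintype.card W * #{φ ∈ S | ∀ w, g (φ w) = w} := by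
  by_contra! hcon
  have h1 : ∑ g : α → W, Fintype.card W ^ Fintype.card W * #{φ ∈ S | ∀ w, g (φ w) = w} <
      ∑ g : α → W, #S := sum_lt_sum_of_nonempty univ_nonempty fun g _ ↦ hcon g
  have h2 : ∑ g : α → W, #{φ ∈ S | ∀ w, g (φ w) = w} =
      ∑ φ ∈ S, #{g : α → W | ∀ w, g (φ w) = w} := by
    simp only [card_filter]
    exact sum_comm
  have h3 : ∑ φ ∈ S, Fintype.card W ^ Fintype.card α ≤
      ∑ φ ∈ S, Fintype.card W ^ Fintype.card W * #{g : α → W | ∀ w, g (φ w) = w} :=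
    sum_le_sum fun φ hφ ↦ card_pow_le_mul_card_leftInverse (hS φ hφ)
  rw [← mul_sum, h2, mul_sum, sum_const, card_univ, Fintype.card_fun, smul_eq_mul] at h1
  rw [sum_const, smul_eq_mul] at h3
  rw [mul_comm] at h3
  omega

/-- Greedy choice: each new colouring handles at least the average share of the maps still missed.
-/
lemma exists_colorings_missing_few {α W : Type*} [Fintype α] [Fintype W] [Nonempty W]
    [DecidableEq α] [DecidableEq W] (S : Finset (W → α)) (hS : ∀ φ ∈ S, Function.Injective φ)
    (t : ℕ) :
    ∃ g : ℕ → α → W,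
      (Fintype.card W ^ Fintype.card W) ^ t * #{φ ∈ S | ∀ i < t, ¬ ∀ w, g i (φ w) = w} ≤
        (Fintype.card W ^ Fintype.card W - 1) ^ t * #S := by
  set Q := Fintype.card W ^ Fintype.card W
  induction t with
  | zero =>
    refine ⟨fun _ _ ↦ Classical.arbitrary W, ?_⟩
    simp
  | succ t ih =>
    obtain ⟨g, hg⟩ := ih
    set R := {φ ∈ S | ∀ i < t, ¬ ∀ w, g i (φ w) = w} with hR
    obtain ⟨f, hf⟩ := exists_leftInverse_of_many R fun φ hφ ↦ hS φ (mem_filter.1 hφ).1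
    refine ⟨Function.update g t f, ?_⟩
    have hset : {φ ∈ S | ∀ i < t + 1, ¬ ∀ w, Function.update g t f i (φ w) = w} =
        {φ ∈ R | ¬ ∀ w, f (φ w) = w} := by
      ext φ
      simp only [hR, mem_filter, and_assoc, and_congr_right_iff, Nat.lt_succ_iff_lt_or_eq, or_imp,
        forall_and, forall_eq, Function.update_self]
      intro _
      refine and_congr_left fun _ ↦ forall₂_congr fun i hi ↦ ?_
      rw [Function.update_of_ne hi.ne]
    rw [hset]
    have hsplit := card_filter_add_card_filter_not (s := R) (fun φ ↦ ∀ w, f (φ w) = w)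
    set a := #{φ ∈ R | ∀ w, f (φ w) = w}
    set b := #{φ ∈ R | ¬ ∀ w, f (φ w) = w}
    have hstep : Q * b ≤ (Q - 1) * #R := by
      have hQ : 1 ≤ Q := Nat.one_le_pow _ _ Fintype.card_pos
      obtain ⟨q, hq⟩ := Nat.exists_eq_add_of_le' hQ
      change #R ≤ Q * a at hf
      rw [hq] at hf ⊢
      rw [Nat.add_sub_cancel]
      nlinarith
    calc Q ^ (t + 1) * b = Q ^ t * (Q * b) := by ring
      _ ≤ Q ^ t * ((Q - 1) * #R) := by gcongr
      _ = (Q - 1) * (Q ^ t * #R) := by ring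
      _ ≤ (Q - 1) * ((Q - 1) ^ t * #S) := by gcongr
      _ = (Q - 1) ^ (t + 1) * #S := by ring

/-- Perfect hash families of logarithmic size. -/
lemma exists_perfect_hash_family (W : Type*) [Finite W] [Nonempty W] :
    ∃ K : ℕ, 1 ≤ K ∧ ∀ m, 1 ≤ m → ∃ h : ℕ → ℕ → W, ∀ φ : W → ℕ, Function.Injective φ →
      (∀ w, φ w < 2 ^ m) → ∃ i < K * m, ∀ w, h i (φ w) = w := by
  classical
  have := Fintype.ofFinite W
  set k := Fintype.card W with hk
  set Q := k ^ k with hQdef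
  have hQ : 1 ≤ Q := Nat.one_le_pow _ _ Fintype.card_pos
  -- There are at most `2 ^ (k * m)` injections; this `K` leaves fewer than one of them missed after
  -- `K * m` colourings.
  obtain ⟨K, hK1, hK⟩ : ∃ K : ℕ, 1 ≤ K ∧ (Q - 1) ^ K * 2 ^ k < Q ^ K := by
    have hQ' : (0 : ℝ) < Q := by exact_mod_cast hQ
    obtain ⟨K, hK⟩ := exists_pow_lt_of_lt_one (show (0 : ℝ) < (2 ^ k)⁻¹ by positivity)
      (show ((Q - 1 : ℕ) : ℝ) / Q < 1 by
        rw [div_lt_one hQ']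
        exact_mod_cast Nat.sub_lt hQ one_pos)
    have hlt : ((Q - 1 : ℕ) : ℝ) ^ K * 2 ^ k < Q ^ K := by
      rw [div_pow, div_lt_iff₀ (by positivity), inv_mul_eq_div, lt_div_iff₀ (by positivity)] at hK
      exact hK
    have hlt' : (Q - 1) ^ K * 2 ^ k < Q ^ K := by exact_mod_cast hlt
    refine ⟨K, Nat.one_le_iff_ne_zero.2 ?_, hlt'⟩
    rintro rfl
    have := Nat.one_le_two_pow (n := k)
    simp at hlt'
  refine ⟨K, hK1, fun m hm ↦ ?_⟩
  obtain ⟨g, hg⟩ := exists_colorings_missing_few (α := Fin (2 ^ m)) (W := W)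
    {φ | Function.Injective φ} (fun φ hφ ↦ (mem_filter.1 hφ).2) (K * m)
  have hS : #{φ : W → Fin (2 ^ m) | Function.Injective φ} ≤ (2 ^ m) ^ k := by
    refine (card_filter_le _ _).trans ?_
    rw [card_univ, Fintype.card_fun, Fintype.card_fin]
  have hempty : #{φ ∈ ({φ : W → Fin (2 ^ m) | Function.Injective φ} : Finset _) |
      ∀ i < K * m, ¬ ∀ w, g i (φ w) = w} = 0 := by
    by_contra hne
    have h1 : Q ^ (K * m) ≤ (Q - 1) ^ (K * m) * (2 ^ m) ^ k :=
      (Nat.le_mul_of_pos_right _ (Nat.pos_of_ne_zero hne)).trans (hg.trans (by gcongr))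
    have h2 : ((Q - 1) ^ K * 2 ^ k) ^ m < (Q ^ K) ^ m := Nat.pow_lt_pow_left hK (by omega)
    rw [mul_pow, ← pow_mul, ← pow_mul, ← pow_mul, mul_comm k m, pow_mul 2 m k] at h2
    omega
  refine ⟨fun i x ↦ if hx : x < 2 ^ m then g i ⟨x, hx⟩ else Classical.arbitrary W,
    fun φ hφ hlt ↦ ?_⟩
  by_contra! hcon
  rw [card_eq_zero] at hempty
  refine (eq_empty_iff_forall_notMem.1 hempty) (fun w ↦ ⟨φ w, hlt w⟩) ?_
  simp only [mem_filter, mem_univ, true_and]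
  refine ⟨fun a b hab ↦ hφ (Fin.mk.inj_iff.1 hab), fun i hi hall ↦ ?_⟩
  obtain ⟨w, hw⟩ := hcon i hi
  rw [dif_pos (hlt w)] at hw
  exact hw (hall w)

end LocalCert

/-! ### Radius-one views and the upper bound -/

namespace LocalCert

open SimpleGraph

section View

variable {V : Type} {G G' : SimpleGraph V} {ident : V → ℕ} {cert cert' : V → List Bool} {v : V}

lemma mem_nodes_view_one {p : ℕ × List Bool} :
    p ∈ (view G ident cert 1 v).nodes ↔ ∃ u, (G.Adj v u ∨ v = u) ∧ p = (ident u, cert u) := by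
  simp only [view, Set.mem_ofPred_eq, Nat.cast_one, edist_le_one_iff_adj_or_eq]

lemma mem_edges_view_one {p : ℕ × ℕ} :
    p ∈ (view G ident cert 1 v).edges ↔
      ∃ u, G.Adj v u ∧ (p = (ident v, ident u) ∨ p = (ident u, ident v)) := by
  simp only [view, Set.mem_ofPred_eq, Nat.cast_one, edist_le_one_iff_adj_or_eq,
    edist_eq_one_iff_adj]
  constructor
  · rintro ⟨a, b, hab, ha, hb, hne, rfl⟩
    rcases ha with ha | rfl
    · rcases hb with hb | rfl
      · exact absurd ⟨ha, hb⟩ hne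
      · exact ⟨a, ha, Or.inr rfl⟩
    · exact ⟨b, hab, Or.inl rfl⟩
  · rintro ⟨u, hu, rfl | rfl⟩
    · exact ⟨v, u, hu, Or.inr rfl, Or.inl hu, fun h ↦ G.irrefl h.1, rfl⟩
    · exact ⟨u, v, hu.symm, Or.inl hu, Or.inr rfl, fun h ↦ G.irrefl h.2, rfl⟩

lemma mem_edges_view_one_of_injective (hid : Function.Injective ident) {u : V} :
    (ident v, ident u) ∈ (view G ident cert 1 v).edges ↔ G.Adj v u := by
  rw [mem_edges_view_one]
  constructor
  · rintro ⟨x, hx, h | h⟩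
    · rw [Prod.mk.injEq] at h
      rwa [hid h.2]
    · rw [Prod.mk.injEq] at h
      rw [hid h.1] at hx
      exact absurd hx (G.irrefl)
  · exact fun h ↦ ⟨u, h, Or.inl rfl⟩

/-- The view at distance one depends only on the neighbourhood and on the certificates there. -/
lemma view_one_congr (hadj : ∀ u, G.Adj v u ↔ G'.Adj v u) (hv : cert v = cert' v)
    (hu : ∀ u, G.Adj v u → cert u = cert' u) :
    view G ident cert 1 v = view G' ident cert' 1 v := by
  have hnodes : (view G ident cert 1 v).nodes = (view G' ident cert' 1 v).nodes := by
    ext p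
    rw [mem_nodes_view_one, mem_nodes_view_one]
    refine exists_congr fun u ↦ ?_
    rw [hadj]
    refine and_congr_right fun h ↦ ?_
    have : cert u = cert' u := by
      rcases h with h | rfl
      · exact hu u ((hadj u).2 h)
      · exact hv
    rw [this]
  have hedges : (view G ident cert 1 v).edges = (view G' ident cert' 1 v).edges := by
    ext p
    simp only [mem_edges_view_one, hadj]
  simp only [view, View.mk.injEq]
  exact ⟨trivial, hnodes, hedges⟩

end View

variable {W : Type*}

/-- The verification algorithm for `T`-freeness. The certificates have length `K * m`, where `m`
bounds the bit length of all identifiers, and the bit with index `i` marks the roots of branches of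
`T` for the colouring `h m i` of the identifiers. -/
def treeVerifier (T : SimpleGraph W) (r : W) (K : ℕ) (h : ℕ → ℕ → ℕ → W) (X : View) : Prop :=
  ∃ m, X.center < 2 ^ m ∧ (∀ p ∈ X.nodes, p.2.length = K * m) ∧ ∀ i < K * m,
    (∀ w, T.IsChild r (h m i X.center) w → ∃ q ∈ X.nodes, (X.center, q.1) ∈ X.edges ∧
      h m i q.1 = w ∧ q.2[i]? = some true) →
    h m i X.center ≠ r ∧ ∀ p ∈ X.nodes, p.1 = X.center → p.2[i]? = some true

lemma treeVerifier_view {T : SimpleGraph W} {r : W} {K : ℕ} {h : ℕ → ℕ → ℕ → W} {V : Type}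
    {G : SimpleGraph V} {ident : V → ℕ} (hid : Function.Injective ident) {cert : V → List Bool}
    {v : V} :
    treeVerifier T r K h (view G ident cert 1 v) ↔
      ∃ m, ident v < 2 ^ m ∧ (∀ u, G.Adj v u ∨ v = u → (cert u).length = K * m) ∧ ∀ i < K * m,
        (∀ w, T.IsChild r (h m i (ident v)) w → ∃ x, G.Adj v x ∧ h m i (ident x) = w ∧
          (cert x)[i]? = some true) →
        h m i (ident v) ≠ r ∧ (cert v)[i]? = some true := by
  have hc : (view G ident cert 1 v).center = ident v := rfl
  simp only [treeVerifier, hc]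
  refine exists_congr fun m ↦ and_congr_right fun _ ↦ and_congr ?_ (forall₂_congr fun i _ ↦
    imp_congr (forall₂_congr fun w _ ↦ ?_) (and_congr_right fun _ ↦ ?_))
  · simp only [mem_nodes_view_one]
    constructor
    · exact fun H u hu ↦ H _ ⟨u, hu, rfl⟩
    · rintro H _ ⟨u, hu, rfl⟩
      exact H u hu
  · simp only [mem_nodes_view_one]
    constructor
    · rintro ⟨_, ⟨u, _, rfl⟩, he, hw, hb⟩
      exact ⟨u, (mem_edges_view_one_of_injective hid).1 he, hw, hb⟩
    · rintro ⟨u, hu, hw, hb⟩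
      exact ⟨_, ⟨u, Or.inl hu, rfl⟩, (mem_edges_view_one_of_injective hid).2 hu, hw, hb⟩
  · simp only [mem_nodes_view_one]
    constructor
    · exact fun H ↦ H _ ⟨v, Or.inr rfl, rfl⟩ rfl
    · rintro H _ ⟨u, _, rfl⟩ hu
      rwa [hid hu]

lemma hasLocalCertification_treeFree [Finite W] {T : SimpleGraph W} (hT : T.IsTree) {K : ℕ}
    (hK : 1 ≤ K) (h : ℕ → ℕ → ℕ → W)
    (hh : ∀ m, 1 ≤ m → ∀ φ : W → ℕ, Function.Injective φ → (∀ w, φ w < 2 ^ m) →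
      ∃ i < K * m, ∀ w, h m i (φ w) = w) (c : ℕ) :
    HasLocalCertification c 1 (fun _ G => T.Free G) fun n ↦ K * Nat.size (n ^ c) := by
  classical
  obtain ⟨r⟩ := hT.1.nonempty
  refine ⟨treeVerifier T r K h, fun V _ G ident hid ↦ ⟨fun hG ↦ ?_, fun hG cert ↦ ?_⟩⟩
  · set m := Nat.size (Fintype.card V ^ c)
    let cert : V → List Bool := fun v ↦ List.ofFn fun i : Fin (K * m) ↦
      decide (IsBranchRoot T r G (fun u ↦ h m i (ident u)) v)
    have hbit : ∀ i < K * m, ∀ v, (cert v)[i]? = some true ↔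
        IsBranchRoot T r G (fun u ↦ h m i (ident u)) v := by
      intro i hi v
      simp [cert, hi]
    refine ⟨cert, fun v ↦ by simp [cert, m], fun v ↦ (treeVerifier_view hid.1).2 ?_⟩
    refine ⟨m, (hid.2 v).2.trans_lt (Nat.lt_size_self _), fun u _ ↦ by simp [cert],
      fun i hi hchild ↦ ?_⟩
    rw [hbit i hi]
    simp only [hbit i hi] at hchild
    have hv : IsBranchRoot T r G (fun u ↦ h m i (ident u)) v := by
      have hex : ∀ w, ∃ x, T.IsChild r (h m i (ident v)) w → G.Adj v x ∧ h m i (ident x) = w ∧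
          IsBranchRoot T r G (fun u ↦ h m i (ident u)) x := by
        intro w
        by_cases hw : T.IsChild r (h m i (ident v)) w
        · obtain ⟨x, hx⟩ := hchild w hw
          exact ⟨x, fun _ ↦ hx⟩
        · exact ⟨v, fun hw' ↦ absurd hw' hw⟩
      choose f hf using hex
      exact ⟨v, f, fun w hw ↦ (hf w hw).1, fun w hw ↦ (hf w hw).2.1, fun w hw ↦ (hf w hw).2.2⟩
    exact ⟨fun hr ↦ hG (hv.isContained hT hr), hv⟩
  · by_contra! hacc
    obtain ⟨φ⟩ := not_not.1 hG
    replace hacc := fun v ↦ (treeVerifier_view hid.1).1 (hacc v)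
    choose m hlt hlen hstep using hacc
    -- Each vertex guesses its own `m`, but neighbours compare certificate lengths, so the guess is
    -- constant on the connected copy.
    have hm : ∀ w, m (φ w) = m (φ r) := by
      intro w
      obtain ⟨p⟩ := hT.1 w r
      clear hstep
      induction p with
      | nil => rfl
      | @cons a b _ hab _ ih =>
        rw [← ih]
        have h1 := hlen (φ a) (φ b) (Or.inl (φ.toHom.map_adj hab))
        rw [hlen (φ b) (φ b) (Or.inr rfl)] at h1
        exact (Nat.eq_of_mul_eq_mul_left hK h1).symm
    have hm1 : 1 ≤ m (φ r) := by
      by_contra! h0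
      have h1 := hlt (φ r)
      have h2 := (hid.2 (φ r)).1
      rw [Nat.lt_one_iff.1 h0] at h1
      omega
    obtain ⟨i, hi, hcol⟩ := hh (m (φ r)) hm1 (fun w ↦ ident (φ w))
      (hid.1.comp φ.injective) fun w ↦ hm w ▸ hlt (φ w)
    have hb := Copy.mem_of_closed r (col := fun v ↦ h (m (φ r)) i (ident v))
      (b := fun v ↦ (cert v)[i]? = some true) φ hcol ?_
    · refine (hstep (φ r) i hi fun w hw ↦ ?_).1 (hcol r)
      rw [hcol r] at hw
      exact ⟨φ w, φ.toHom.map_adj hw.1, hcol w, hb w⟩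
    · rintro _ ⟨w, rfl⟩ hchild
      have := hstep (φ w) i
      rw [hm w] at this
      exact (this hi hchild).2

lemma size_pow_le_mul_log (c : ℕ) {n : ℕ} (hn : 2 ≤ n) :
    (Nat.size (n ^ c) : ℝ) ≤ ((c + 1) / Real.log 2) * Real.log n := by
  have h2 : (0 : ℝ) < Real.log 2 := Real.log_pos one_lt_two
  have hlog : Real.log 2 ≤ Real.log n := Real.log_le_log two_pos (by exact_mod_cast hn)
  obtain ⟨k, hk⟩ : ∃ k, Nat.size (n ^ c) = k + 1 :=
    Nat.exists_eq_succ_of_ne_zero (Nat.size_pos.2 (by positivity)).ne'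
  have hpow : 2 ^ k ≤ n ^ c := Nat.lt_size.1 (by omega)
  have hle : (k : ℝ) * Real.log 2 ≤ c * Real.log n := by
    rw [← Real.log_pow, ← Real.log_pow]
    exact Real.log_le_log (by positivity) (by exact_mod_cast hpow)
  rw [hk, div_mul_eq_mul_div, le_div_iff₀ h2]
  push_cast
  linarith

theorem exists_hasLocalCertification_treeFree_log [Finite W] {T : SimpleGraph W} (hT : T.IsTree)
    (c : ℕ) :
    ∃ (s : ℕ → ℕ) (C : ℝ), HasLocalCertification c 1 (fun _ G => T.Free G) s ∧
      ∀ n : ℕ, 2 ≤ n → (s n : ℝ) ≤ C * Real.log n := by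
  have := hT.1.nonempty
  obtain ⟨K, hK, hfam⟩ := exists_perfect_hash_family W
  have hfam' : ∀ m, ∃ h : ℕ → ℕ → W, 1 ≤ m → ∀ φ : W → ℕ, Function.Injective φ →
      (∀ w, φ w < 2 ^ m) → ∃ i < K * m, ∀ w, h i (φ w) = w := by
    intro m
    by_cases hm : 1 ≤ m
    · obtain ⟨h, hh⟩ := hfam m hm
      exact ⟨h, fun _ ↦ hh⟩
    · exact ⟨fun _ _ ↦ Classical.arbitrary W, fun hm' ↦ absurd hm' hm⟩
  choose h hh using hfam'
  refine ⟨_, K * ((c + 1) / Real.log 2), hasLocalCertification_treeFree hT hK h hh c,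
    fun n hn ↦ ?_⟩
  push_cast
  rw [mul_assoc]
  exact mul_le_mul_of_nonneg_left (size_pow_le_mul_log c hn) (Nat.cast_nonneg K)

end LocalCert

/-! ### The lower bound -/

namespace LocalCert

open SimpleGraph

/-- Pigeonhole twice: every row repeats a value in two columns, and two rows agree on both the
column pair and the value. -/
lemma exists_monochromatic_rectangle {A B C : Type*} [Fintype A] [Fintype B] [Fintype C]
    (hB : Fintype.card C < Fintype.card B)
    (hA : Fintype.card B * Fintype.card B * Fintype.card C < Fintype.card A) (f : A → B → C) :
    ∃ (i : Bool → A) (j : Bool → B) (κ : C), Function.Injective i ∧ Function.Injective j ∧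
      ∀ s t, f (i s) (j t) = κ := by
  have hrow : ∀ a, ∃ b b', b ≠ b' ∧ f a b = f a b' := fun a ↦
    Fintype.exists_ne_map_eq_of_card_lt (f a) hB
  choose b b' hne heq using hrow
  obtain ⟨x, y, hxy, h⟩ := Fintype.exists_ne_map_eq_of_card_lt
    (fun a ↦ ((b a, b' a), f a (b a))) (by simpa only [Fintype.card_prod] using hA)
  simp only [Prod.mk.injEq] at h
  obtain ⟨⟨h1, h2⟩, h3⟩ := h
  have h4 := heq y
  rw [← h1, ← h2] at h4
  rw [← h1] at h3
  refine ⟨fun s ↦ cond s x y, fun t ↦ cond t (b x) (b' x), f x (b x), ?_, ?_, ?_⟩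
  · rintro (_ | _) (_ | _) h <;> simp_all
  · rintro (_ | _) (_ | _) h
    · rfl
    · exact absurd h.symm (hne x)
    · exact absurd h (hne x)
    · rfl
  · rintro (_ | _) (_ | _)
    · exact h4.symm.trans h3.symm
    · exact h3.symm
    · exact (heq x).symm
    · rfl

section Tree

variable {W : Type*} {T : SimpleGraph W} {u p w : W}

/-- `w` is a leaf with neighbour `p`, and `p` is at distance at least three from `u`. -/
structure IsFarLeaf (T : SimpleGraph W) (u p w : W) : Prop where
  adj : T.Adj p w
  eq_of_adj : ∀ y, T.Adj y w → y = p
  three_le_dist : 3 ≤ T.dist u p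
  ne : u ≠ w

/-- Take `u`, `w` at maximal distance: a second neighbour of `w` would be farther from `u`. -/
lemma exists_isFarLeaf [Finite W] (hT : T.IsTree) (hd : 4 ≤ T.diam) :
    ∃ u p w, IsFarLeaf T u p w := by
  have := hT.1.nonempty
  have : Nontrivial W := nontrivial_of_diam_ne_zero (G := T) (by omega)
  obtain ⟨u, w, huw⟩ := T.exists_dist_eq_diam
  have hle : ∀ y, T.dist u y ≤ T.dist u w := by
    intro y
    rw [huw]
    exact dist_le_diam (connected_iff_ediam_ne_top.1 hT.1)
  have hwu : w ≠ u := by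
    rintro rfl
    rw [dist_self] at huw
    omega
  obtain ⟨p, hp, hpd⟩ := hT.1.exists_adj_dist_add_one hwu
  refine ⟨u, p, w, hp, fun y hy ↦ ?_, by omega, hwu.symm⟩
  refine hT.eq_of_adj_of_dist_add_one hy hp ?_ hpd
  rcases hT.dist_eq_add_one_or u hy with h | h
  · exact h
  · have := hle y
    omega

/-- The graph obtained from `T` by moving the end `w` of the leaf edge at `p` to `u`. -/
def closeUp (T : SimpleGraph W) (u p w : W) : SimpleGraph W where
  Adj x y := x ≠ y ∧ ((x ≠ w ∧ y ≠ w ∧ T.Adj x y) ∨ (x = u ∧ y = p) ∨ (x = p ∧ y = u))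
  symm := ⟨fun x y ⟨hne, h⟩ ↦ ⟨hne.symm, by
    rcases h with ⟨h1, h2, h3⟩ | ⟨h1, h2⟩ | ⟨h1, h2⟩
    · exact Or.inl ⟨h2, h1, h3.symm⟩
    · exact Or.inr (Or.inr ⟨h2, h1⟩)
    · exact Or.inr (Or.inl ⟨h2, h1⟩)⟩⟩
  loopless := ⟨fun _ h ↦ h.1 rfl⟩

/-- The pair `x, y` is the moved edge of `closeUp`. -/
def IsMoved (u p x y : W) : Prop := (x = u ∧ y = p) ∨ (x = p ∧ y = u)

lemma IsMoved.symm {x y : W} (h : IsMoved u p x y) : IsMoved u p y x :=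
  (Or.symm h).imp And.symm And.symm

/-- Two copies of `closeUp` in which the moved edges are crossed. -/
def crossed (T : SimpleGraph W) (u p w : W) : SimpleGraph (Bool × W) where
  Adj a b := (closeUp T u p w).Adj a.2 b.2 ∧ (a.1 = b.1 ↔ ¬ IsMoved u p a.2 b.2)
  symm := ⟨fun a b ⟨h1, h2⟩ ↦ ⟨h1.symm, by
    rw [eq_comm, h2, not_iff_not]
    exact ⟨IsMoved.symm, IsMoved.symm⟩⟩⟩
  loopless := ⟨fun a h ↦ (closeUp T u p w).irrefl h.1⟩

lemma IsFarLeaf.u_ne_p (h : IsFarLeaf T u p w) : u ≠ p := by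
  rintro rfl
  simpa using h.three_le_dist

lemma IsFarLeaf.ne_of_closeUp_adj (h : IsFarLeaf T u p w) {x y : W}
    (hxy : (closeUp T u p w).Adj x y) : x ≠ w := by
  rcases hxy.2 with ⟨h1, -, -⟩ | ⟨rfl, -⟩ | ⟨rfl, -⟩
  · exact h1
  · exact h.ne
  · exact h.adj.ne

/-- No vertex of `T` is isolated, whereas `w` is isolated in `closeUp`, so one vertex too few is
available. -/
lemma IsFarLeaf.free_map_closeUp [Finite W] (h : IsFarLeaf T u p w) (hT : T.IsTree) {V : Type*}
    (g : W ↪ V) : T.Free ((closeUp T u p w).map g) := by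
  rintro ⟨φ⟩
  have hnbr : ∀ x, ∃ y, T.Adj x y := by
    intro x
    by_cases hx : x = u
    · subst hx
      obtain ⟨y, hy, -⟩ := hT.1.exists_adj_dist_add_one h.ne
      exact ⟨y, hy.symm⟩
    · obtain ⟨y, hy, -⟩ := hT.1.exists_adj_dist_add_one hx
      exact ⟨y, hy.symm⟩
  have hpre : ∀ x, ∃ z, z ≠ w ∧ g z = φ x := by
    intro x
    obtain ⟨y, hy⟩ := hnbr x
    obtain ⟨a, b, hab, ha, -⟩ := (map_adj _ _ _ _).1 (φ.toHom.map_adj hy)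
    exact ⟨a, h.ne_of_closeUp_adj hab, ha⟩
  choose z hz hgz using hpre
  have hinj : Function.Injective z := fun a b hab ↦
    φ.injective (show φ a = φ b by rw [← hgz a, ← hgz b, hab])
  obtain ⟨x, hx⟩ := Finite.surjective_of_injective hinj w
  exact hz x hx

/-- The vertex `u` of the other copy takes over the role of the leaf `w`. -/
lemma IsFarLeaf.isContained_crossed (h : IsFarLeaf T u p w) : T.IsContained (crossed T u p w) := by
  classical
  have hup : ¬ T.Adj u p := fun hadj ↦ by
    have := h.three_le_dist
    rw [dist_eq_one_iff_adj.2 hadj] at this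
    omega
  have hmoved : ∀ {x y}, T.Adj x y → ¬ IsMoved u p x y := by
    rintro x y hxy (⟨rfl, rfl⟩ | ⟨rfl, rfl⟩)
    · exact hup hxy
    · exact hup hxy.symm
  have hleaf : (crossed T u p w).Adj (false, p) (true, u) :=
    ⟨⟨h.u_ne_p.symm, Or.inr (Or.inr ⟨rfl, rfl⟩)⟩,
      iff_of_false (by simp) fun hn ↦ hn (Or.inr ⟨rfl, rfl⟩)⟩
  refine ⟨⟨⟨fun x ↦ if x = w then (true, u) else (false, x), ?_⟩, ?_⟩⟩
  · intro x y hxy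
    by_cases hx : x = w
    · subst hx
      rw [h.eq_of_adj y hxy.symm, if_pos rfl, if_neg h.adj.ne]
      exact hleaf.symm
    · by_cases hy : y = w
      · subst hy
        rw [h.eq_of_adj x hxy, if_pos rfl, if_neg h.adj.ne]
        exact hleaf
      · rw [if_neg hx, if_neg hy]
        exact ⟨⟨hxy.ne, Or.inl ⟨hx, hy, hxy⟩⟩, iff_of_true rfl (hmoved hxy)⟩
  · intro x y hxy
    change (if x = w then (true, u) else (false, x)) = (if y = w then (true, u) else (false, y))
      at hxy
    split_ifs at hxy with hx hy hy <;> simp_all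

variable {A B V : Type*} (T u) (e : (A ⊕ B) × W ↪ V)

/-- The vertices close to `u` are placed in block `i` and the other ones in block `j`. -/
noncomputable def place (i : A) (j : B) : W ↪ V where
  toFun x := e (if T.dist u x ≤ 1 then Sum.inl i else Sum.inr j, x)
  inj' _ _ h := congrArg Prod.snd (e.injective h)

variable {T u e}

lemma place_of_le {i : A} {j : B} {x : W} (hx : T.dist u x ≤ 1) :
    place T u e i j x = e (Sum.inl i, x) := by
  exact congrArg (fun a ↦ e (a, x)) (if_pos hx)

lemma place_of_lt {i : A} {j : B} {x : W} (hx : 1 < T.dist u x) :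
    place T u e i j x = e (Sum.inr j, x) := by
  exact congrArg (fun a ↦ e (a, x)) (if_neg hx.not_ge)

variable (T u e)

/-- The two copies of the vertices, placed in two blocks of either kind. -/
noncomputable def placeTwo (i : Bool → A) (j : Bool → B) (hi : Function.Injective i)
    (hj : Function.Injective j) : Bool × W ↪ V where
  toFun a := place T u e (i a.1) (j a.1) a.2
  inj' := by
    rintro ⟨s, x⟩ ⟨t, y⟩ h
    have hxy : x = y := congrArg Prod.snd (e.injective h)
    subst hxy
    rcases le_or_gt (T.dist u x) 1 with hx | hx
    · simp only [place_of_le hx, EmbeddingLike.apply_eq_iff_eq, Prod.mk.injEq, Sum.inl.injEq,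
        and_true] at h
      rw [hi h]
    · simp only [place_of_lt hx, EmbeddingLike.apply_eq_iff_eq, Prod.mk.injEq, Sum.inr.injEq,
        and_true] at h
      rw [hj h]

variable {T u e}

/-- Around every vertex, the crossed graph looks like a single copy of `closeUp`. -/
lemma IsFarLeaf.exists_place (h : IsFarLeaf T u p w) (hT : T.Connected) {i : Bool → A}
    {j : Bool → B} (hi : Function.Injective i) (hj : Function.Injective j) (s : Bool) (x : W) :
    ∃ s' t', place T u e (i s') (j t') x = placeTwo T u e i j hi hj (s, x) ∧
      ∀ t y, (crossed T u p w).Adj (s, x) (t, y) →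
        place T u e (i s') (j t') y = placeTwo T u e i j hi hj (t, y) := by
  have hu : T.dist u u ≤ 1 := by simp
  have hp : 1 < T.dist u p := by have := h.three_le_dist; omega
  have hplace : ∀ t y, placeTwo T u e i j hi hj (t, y) = place T u e (i t) (j t) y :=
    fun _ _ ↦ rfl
  simp only [hplace]
  have hT' : ∀ {t y}, (crossed T u p w).Adj (s, x) (t, y) →
      (T.Adj x y ∧ t = s) ∨ (IsMoved u p x y ∧ t = !s) := by
    rintro t y ⟨⟨-, hxy⟩, hst⟩
    by_cases hm : IsMoved u p x y
    · right
      refine ⟨hm, ?_⟩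
      have : s ≠ t := fun hs ↦ hst.1 hs hm
      revert this
      cases s <;> cases t <;> simp
    · rcases hxy with ⟨-, -, hxy⟩ | hxy
      · exact Or.inl ⟨hxy, (hst.2 hm).symm⟩
      · exact absurd hxy hm
  by_cases hxu : x = u
  · subst hxu
    -- The `T`-neighbours of `u` share its near block; the moved edge leads to the far block of the
    -- other copy.
    refine ⟨s, !s, by rw [place_of_le hu, place_of_le hu], fun t y hty ↦ ?_⟩
    rcases hT' hty with ⟨hy, rfl⟩ | ⟨⟨-, rfl⟩ | ⟨hx, -⟩, rfl⟩
    · have hy1 : T.dist x y ≤ 1 := (dist_eq_one_iff_adj.2 hy).le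
      rw [place_of_le hy1, place_of_le hy1]
    · rw [place_of_lt hp, place_of_lt hp]
    · exact absurd hx h.u_ne_p
  by_cases hxp : x = p
  · subst hxp
    -- Mirror case: as `p` is at distance at least three from `u`, all its `T`-neighbours lie in the
    -- far block.
    refine ⟨!s, s, by rw [place_of_lt hp, place_of_lt hp], fun t y hty ↦ ?_⟩
    rcases hT' hty with ⟨hy, rfl⟩ | ⟨⟨hx, -⟩ | ⟨-, rfl⟩, rfl⟩
    · have hy1 : 1 < T.dist u y := by
        have h1 := hT.dist_triangle (u := u) (v := y) (w := x)
        rw [dist_eq_one_iff_adj.2 hy.symm] at h1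
        have := h.three_le_dist
        omega
      rw [place_of_lt hy1, place_of_lt hy1]
    · exact absurd hx hxu
    · rw [place_of_le hu, place_of_le hu]
  · refine ⟨s, s, rfl, fun t y hty ↦ ?_⟩
    rcases hT' hty with ⟨-, rfl⟩ | ⟨⟨hx, -⟩ | ⟨hx, -⟩, -⟩
    · rfl
    · exact absurd hx hxu
    · exact absurd hx hxp

lemma exists_crossed_adj {s : Bool} {x y : W} (hxy : (closeUp T u p w).Adj x y) :
    ∃ t, (crossed T u p w).Adj (s, x) (t, y) := by
  by_cases hm : IsMoved u p x y
  · exact ⟨!s, hxy, iff_of_false (by simp) (not_not.2 hm)⟩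
  · exact ⟨s, hxy, iff_of_true rfl hm⟩

end Tree

lemma card_lt_of_hasLocalCertification {W : Type*} [Fintype W] {T : SimpleGraph W}
    (hT : T.IsTree) {u p w : W} (h : IsFarLeaf T u p w) {c : ℕ} (hc : 1 ≤ c) {s : ℕ → ℕ}
    (hs : HasLocalCertification c 1 (fun _ G => T.Free G) s) (n : ℕ) :
    n < 7 * Fintype.card W * (27 ^ Fintype.card W) ^ s n := by
  classical
  by_contra! hn
  obtain ⟨accept, hacc⟩ := hs
  -- A string of at most `s n` bits is encoded by its lookups, with `none` past the end; hence `3`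
  -- values per position.
  let C := W → Fin (s n) → Option Bool
  set Q := Fintype.card C with hQ
  have hQ3 : Q ^ 3 = (27 ^ Fintype.card W) ^ s n := by
    rw [hQ, Fintype.card_fun, Fintype.card_fun, Fintype.card_option, Fintype.card_bool,
      Fintype.card_fin, show 27 = 3 ^ 3 from rfl]
    simp only [← pow_mul]
    congr 1
    ring
  have hQ1 : 1 ≤ Q := Fintype.card_pos
  let A := Fin ((Q + 1) * (Q + 1) * Q + 1)
  let B := Fin (Q + 1)
  obtain ⟨e⟩ : Nonempty ((A ⊕ B) × W ↪ Fin n) := by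
    refine Function.Embedding.nonempty_of_card_le ?_
    rw [Fintype.card_prod, Fintype.card_sum, Fintype.card_fin, Fintype.card_fin, Fintype.card_fin]
    refine le_trans ?_ hn
    rw [← hQ3]
    have : (Q + 1) * (Q + 1) * Q + 1 + (Q + 1) ≤ 7 * Q ^ 3 := by
      have h1 : Q ≤ Q ^ 3 := Nat.le_self_pow (by norm_num) Q
      have h2 : Q ^ 2 ≤ Q ^ 3 := Nat.pow_le_pow_right hQ1 (by norm_num)
      nlinarith
    calc _ ≤ 7 * Q ^ 3 * Fintype.card W := Nat.mul_le_mul_right _ this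
      _ = _ := by ring
  let ident : Fin n → ℕ := fun v ↦ v + 1
  have hid : IsIdentifier c ident := by
    refine ⟨fun a b hab ↦ Fin.ext (Nat.succ_injective hab), fun v ↦ ⟨by simp [ident], ?_⟩⟩
    rw [Fintype.card_fin]
    exact (Nat.succ_le_of_lt v.2).trans (Nat.le_self_pow (by omega) n)
  have hyes : ∀ (a : A) (b : B), ∃ cert : Fin n → List Bool, (∀ v, (cert v).length ≤ s n) ∧
      ∀ v, accept (view ((closeUp T u p w).map (place T u e a b)) ident cert 1 v) := by
    intro a b
    simpa using (hacc (Fin n) _ ident hid).1 (h.free_map_closeUp hT (place T u e a b))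
  choose cert hlen hcert using hyes
  -- Certificates for the isolated vertices outside the two copies come from the edgeless graph.
  obtain ⟨cert₀, -, hcert₀⟩ := (hacc (Fin n) ⊥ ident hid).1
    (free_bot fun hbot ↦ by simpa [hbot] using h.adj)
  obtain ⟨i, j, κ, hi, hj, hκ⟩ := exists_monochromatic_rectangle (A := A) (B := B) (C := C)
    (by rw [Fintype.card_fin]; exact Nat.lt_succ_self _)
    (by rw [Fintype.card_fin, Fintype.card_fin]; exact Nat.lt_succ_self _)
    fun a b x t ↦ (cert a b (place T u e a b x))[(t : ℕ)]?
  let g := placeTwo T u e i j hi hj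
  let κ' : Bool × W → List Bool := fun a ↦
    cert (i false) (j false) (place T u e (i false) (j false) a.2)
  have hκ' : ∀ s' t' (a : Bool × W),
      cert (i s') (j t') (place T u e (i s') (j t') a.2) = κ' a := by
    intro s' t' a
    refine List.ext_getElem? fun k ↦ ?_
    by_cases hk : k < s n
    · exact congrFun (congrFun ((hκ s' t').trans (hκ false false).symm) a.2) ⟨k, hk⟩
    · rw [List.getElem?_eq_none ((hlen _ _ _).trans (not_lt.1 hk)),
        List.getElem?_eq_none ((hlen _ _ _).trans (not_lt.1 hk))]
  let cert' : Fin n → List Bool := Function.extend g κ' cert₀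
  have hg : ∀ a, cert' (g a) = κ' a := fun a ↦ g.injective.extend_apply κ' cert₀ a
  obtain ⟨v, hv⟩ := (hacc (Fin n) ((crossed T u p w).map g) ident hid).2
    (not_not.2 (h.isContained_crossed.trans ⟨(Embedding.map g _).toCopy⟩)) cert'
  apply hv
  by_cases hvg : ∃ a, g a = v
  · obtain ⟨⟨b, x⟩, rfl⟩ := hvg
    obtain ⟨s', t', hx, hnbr⟩ := h.exists_place (e := e) hT.1 hi hj b x
    have hview := hcert (i s') (j t') (g (b, x))
    rw [view_one_congr (G' := (crossed T u p w).map g) (cert' := cert')] at hview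
    · exact hview
    · intro z
      simp only [map_adj]
      constructor
      · rintro ⟨x', y, hxy, hx', rfl⟩
        obtain rfl : x' = x := (place T u e (i s') (j t')).injective (hx'.trans hx.symm)
        obtain ⟨t, ht⟩ := exists_crossed_adj (s := b) hxy
        exact ⟨_, _, ht, rfl, (hnbr t y ht).symm⟩
      · rintro ⟨a, ⟨t, y⟩, hay, ha, rfl⟩
        obtain rfl := g.injective ha
        exact ⟨x, y, hay.1, hx, hnbr t y hay⟩
    · rw [hg, ← hκ' s' t', hx]
    · intro z hz
      obtain ⟨x', y, hxy, hx', rfl⟩ := (map_adj _ _ _ _).1 hz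
      obtain rfl : x' = x := (place T u e (i s') (j t')).injective (hx'.trans hx.symm)
      obtain ⟨t, ht⟩ := exists_crossed_adj (s := b) hxy
      rw [hnbr t y ht]
      change _ = cert' (g (t, y))
      rw [hg, ← hκ' s' t']
      exact congrArg _ (hnbr t y ht).symm
  · have hview := hcert₀ v
    rw [view_one_congr (G' := (crossed T u p w).map g) (cert' := cert')] at hview
    · exact hview
    · intro z
      refine iff_of_false (by simp) fun hz ↦ ?_
      obtain ⟨a, -, -, ha, -⟩ := (map_adj _ _ _ _).1 hz
      exact hvg ⟨a, ha⟩
    · exact (Function.extend_apply' κ' cert₀ v hvg).symm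
    · simp

theorem exists_mul_log_le_of_hasLocalCertification {W : Type*} [Finite W] {T : SimpleGraph W}
    (hT : T.IsTree) (hd : 4 ≤ T.diam) :
    ∃ (ε : ℝ) (N : ℕ), 0 < ε ∧ ∀ c : ℕ, 1 ≤ c → ∀ s : ℕ → ℕ,
      HasLocalCertification c 1 (fun _ G => T.Free G) s →
        ∀ n : ℕ, N ≤ n → ε * Real.log n ≤ (s n : ℝ) := by
  have := Fintype.ofFinite W
  have := hT.1.nonempty
  obtain ⟨u, p, w, h⟩ := exists_isFarLeaf hT hd
  set k := Fintype.card W with hk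
  have hk0 : 0 < k := Fintype.card_pos
  have hL : 0 < Real.log ((27 : ℝ) ^ k) := Real.log_pos (one_lt_pow₀ (by norm_num) hk0.ne')
  -- For `n` at least `(7 * k) ^ 2`, the term `log (7 * k)` costs at most half of `log n`; hence the
  -- factor `2`.
  refine ⟨1 / (2 * Real.log ((27 : ℝ) ^ k)), (7 * k) ^ 2, by positivity, fun c hc s hs n hn ↦ ?_⟩
  have hn0 : 0 < n := lt_of_lt_of_le (by positivity) hn
  have h1 : (n : ℝ) ≤ (7 * k) * ((27 : ℝ) ^ k) ^ s n := by
    exact_mod_cast (card_lt_of_hasLocalCertification hT h hc hs n).le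
  have h2 : Real.log n ≤ Real.log (7 * k) + s n * Real.log ((27 : ℝ) ^ k) := by
    have := Real.log_le_log (by exact_mod_cast hn0) h1
    rwa [Real.log_mul (by positivity) (by positivity), Real.log_pow] at this
  have h3 : 2 * Real.log (7 * k) ≤ Real.log n := by
    have := Real.log_le_log (by positivity) (show ((7 * k : ℝ)) ^ 2 ≤ n by exact_mod_cast hn)
    rwa [Real.log_pow] at this
  rw [one_div, inv_mul_le_iff₀ (by positivity)]
  linarith

end LocalCert

theorem mainTheorem9 {W : Type*} [Finite W] (T : SimpleGraph W) (hT : T.IsTree) :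
    (∀ c : ℕ, 1 ≤ c → ∃ (s : ℕ → ℕ) (C : ℝ),
      LocalCert.HasLocalCertification c 1 (fun _ G => T.Free G) s ∧
        ∀ n : ℕ, 2 ≤ n → (s n : ℝ) ≤ C * Real.log n) ∧
    (4 ≤ T.diam → ∃ (ε : ℝ) (N : ℕ), 0 < ε ∧
      ∀ c : ℕ, 1 ≤ c → ∀ s : ℕ → ℕ,
        LocalCert.HasLocalCertification c 1 (fun _ G => T.Free G) s →
          ∀ n : ℕ, N ≤ n → ε * Real.log n ≤ (s n : ℝ)) :=
  ⟨fun c _ ↦ LocalCert.exists_hasLocalCertification_treeFree_log hT c,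
    LocalCert.exists_mul_log_le_of_hasLocalCertification hT⟩
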